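/- Let $q\ge 5$ be a prime power, $q=p^e$ with $p$ prime, and let $m,k$ be integers with $2\le m\le q-3$ and $4\le k\le m+2$. Then there exists a quantum GRL code with parameters $$[[\,m(q+1)+3,\; m(q+1)+3-2k,\; \ge k-1\,]]_q .$$ More precisely, put $n=m(q+1)$. There is a linear code $C\subseteq\mathbb F_{q^2}^{\,n+3}$ which is a generalized Roth–Lempel (GRL) code with $s=3$, that is, the row space of $$\left(\begin{array}{c|c} G_k & \begin{matrix} O\\ A\end{matrix}\end{array}\right),\qquad G_k=(v_j\alpha_j^{\,i})_{0\le i\le k-1,\;1\le j\le n},$$ with distinct $\alpha_1,\dots,\alpha_n\in\mathbb F_{q^2}$, with $v_1,\dots,v_n\in\mathbb F_{q^2}^*$, with a nonsingular $3\times3$ matrix $A$ over $\mathbb F_{q^2}$ placed in the last three rows, and with $O$ the $(k-3)\times 3$ zero matrix, such that * $C$ has dimension $k$ and minimum distance at least $n-k+2$; * $C\subseteq C^{\perp_h}$, where $C^{\perp_h}=\{u:\sum_i u_i c_i^{\,q}=0\ \ \forall c\in C\}$, and $C^{\perp_h}$ has minimum distance at least $k-1$; * some stabilizer code $Q\subseteq(\mathbb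 C^{q})^{\otimes (n+3)}$ obtained from $C$ by the Hermitian construction has dimension $q^{\,n+3-2k}$ and minimum distance $d(Q)\ge k-1$. Here, for a primitive $p$-th root of unity $\omega$ and $a,b\in\mathbb F_q^{\,n+3}$, one sets $X(a)|x\rangle=|x+a\rangle$ and $Z(b)|x\rangle=\omega^{\sum_i\operatorname{Tr}_{\mathbb F_q/\mathbb F_p}(b_ix_i)}|x\rangle$. The errors are the operators $\omega^cX(a)Z(b)$ with $c\in\mathbb Z/p$, of weight $\#\{i:(a_i,b_i)\ne(0,0)\}$. The code $Q$ detects $E$ if there is $\lambda\in\mathbb C$ with $\langle\varphi,E\psi\rangle=\lambda\langle\varphi,\psi\rangle$ for all $\varphi,\psi\in Q$, and $d(Q)=d$ means that $Q$ detects all errors of weight less than $d$ but not some error of weight $d$. The code $Q$ is obtained from $C$ by the Hermitian construction if, for some basis $(\beta,\beta^q)$ of $\mathbb F_{q^2}$ over $\mathbb F_q$, it is a joint eigenspace of all operators $X(a)Z(b)$ with $\beta a+\beta^q b\in C$. -/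

import Mathlib

namespace QuantumGRL

/-! ### Classical codes -/

section Classical

variable {K : Type*} [Field K]

/-- The `k × (n + s)` generator matrix of a generalized Roth-Lempel code: the first `n` columns form
the matrix `(v j * α j ^ i)` with `0 ≤ i < k`; the last `s` columns carry the `s × s` matrix `A` in
their last `s` rows and zeros in the `k - s` rows above. -/
def grlGenerator {n s : ℕ} (k : ℕ) (α v : Fin n → K) (A : Matrix (Fin s) (Fin s) K) :
    Matrix (Fin k) (Fin (n + s)) K :=
  Matrix.of fun i j =>
    Fin.addCases (motive := fun _ => K)
      (fun j' : Fin n => v j' * α j' ^ (i : ℕ))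
      (fun j' : Fin s =>
        if h : k ≤ (i : ℕ) + s then A ⟨(i : ℕ) + s - k, by have := i.isLt; omega⟩ j' else 0)
      j

/-- The code `GRL_k(α, v, A)`: the row space of the generator matrix. -/
def grlCode {n s : ℕ} (k : ℕ) (α v : Fin n → K) (A : Matrix (Fin s) (Fin s) K) :
    Submodule K (Fin (n + s) → K) :=
  Submodule.span K (Set.range fun i : Fin k => grlGenerator k α v A i)

/-- `C` is a generalized Roth-Lempel code `GRL_k(α, v, A)` with `α` consisting of `n` distinct
elements, all entries of `v` nonzero, `A` a nonsingular `s × s` matrix, and `s ≤ k ≤ n`. -/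
def IsGRLCode {n s : ℕ} (k : ℕ) (C : Submodule K (Fin (n + s) → K)) : Prop :=
  s ≤ k ∧ k ≤ n ∧
    ∃ (α v : Fin n → K) (A : Matrix (Fin s) (Fin s) K),
      Function.Injective α ∧ (∀ i, v i ≠ 0) ∧ IsUnit A.det ∧ C = grlCode k α v A

/-- The Hermitian dual code with respect to `⟨u, c⟩ = ∑ i, u i * (c i) ^ q`. -/
def hermitianDual {ι : Type*} [Fintype ι] (q : ℕ) (C : Submodule K (ι → K)) :
    Submodule K (ι → K) where
  carrier := {u | ∀ c ∈ C, ∑ i, u i * c i ^ q = 0}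
  add_mem' := by
    intro u w hu hw c hc
    simp only [Pi.add_apply, add_mul, Finset.sum_add_distrib, hu c hc, hw c hc, add_zero]
  zero_mem' := by
    intro c _
    simp
  smul_mem' := by
    intro r u hu c hc
    simp only [Pi.smul_apply, smul_eq_mul, mul_assoc, ← Finset.mul_sum, hu c hc, mul_zero]

/-- `C` is Hermitian self-orthogonal. -/
def IsHermitianSelfOrthogonal {ι : Type*} [Fintype ι] (q : ℕ) (C : Submodule K (ι → K)) : Prop :=
  C ≤ hermitianDual q C

/-- Every nonzero codeword of `C` has Hamming weight at least `d`. -/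
def MinDistanceGE {ι : Type*} [Fintype ι] [DecidableEq K] (C : Submodule K (ι → K)) (d : ℕ) :
    Prop :=
  ∀ c ∈ C, c ≠ 0 → d ≤ hammingNorm c

end Classical

/-! ### Quantum codes -/

section Quantum

variable {ι F : Type*} [Fintype ι] [Field F]

/-- The state space `⨂_{i ∈ ι} ℂ^F`, in coordinates with respect to its orthonormal basis of the
vectors `|x⟩`, `x ∈ F^ι`. -/
abbrev State (ι F : Type*) : Type _ := EuclideanSpace ℂ (ι → F)

/-- The operator `X(a) : |x⟩ ↦ |x + a⟩`. -/
def opX (a : ι → F) : State ι F →ₗ[ℂ] State ι F where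
  toFun ψ := WithLp.toLp 2 fun x => ψ (x - a)
  map_add' _ _ := rfl
  map_smul' _ _ := rfl

/-- The operator `Z(b) : |x⟩ ↦ ∏ i, ω ^ Tr(b i * x i) |x⟩`, the trace being that from `F` to its
prime field `ZMod p` and `ω` a `p`-th root of unity. -/
noncomputable def opZ (p : ℕ) [Fact p.Prime] [Algebra (ZMod p) F] (ω : ℂ) (b : ι → F) :
    State ι F →ₗ[ℂ] State ι F where
  toFun ψ := WithLp.toLp 2 fun x =>
    (∏ i, ω ^ (Algebra.trace (ZMod p) F (b i * x i)).val) * ψ x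
  map_add' ψ φ := by
    ext x
    simp [mul_add]
  map_smul' r ψ := by
    ext x
    simp [mul_left_comm]

/-- The element `ω ^ c X(a) Z(b)` of the error group. -/
noncomputable def errorOp (p : ℕ) [Fact p.Prime] [Algebra (ZMod p) F] (ω : ℂ) (c : ZMod p)
    (a b : ι → F) : State ι F →ₗ[ℂ] State ι F :=
  ω ^ c.val • (opX a ∘ₗ opZ p ω b)

/-- The quantum weight of `ω ^ c X(a) Z(b)`: the number of `i` with `(a i, b i) ≠ (0, 0)`. -/
def quantumWeight [DecidableEq F] (a b : ι → F) : ℕ :=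
  hammingNorm fun i => (a i, b i)

/-- The code `Q` detects the error `E`: the compression of `E` to `Q` is a scalar. -/
def Detects [DecidableEq ι] [Fintype F] (Q : Submodule ℂ (State ι F)) (E : State ι F →ₗ[ℂ] State ι F) :
    Prop :=
  ∃ r : ℂ, ∀ φ ∈ Q, ∀ ψ ∈ Q, inner ℂ φ (E ψ) = r * inner ℂ φ ψ

/-- `Q` has minimum distance `d`: it detects every error of weight less than `d` and fails to detect
some error of weight `d`. -/
def HasQuantumDistance [DecidableEq ι] [Fintype F] [DecidableEq F]
    (p : ℕ) [Fact p.Prime] [Algebra (ZMod p) F]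
    (ω : ℂ) (Q : Submodule ℂ (State ι F)) (d : ℕ) : Prop :=
  (∀ (c : ZMod p) (a b : ι → F), quantumWeight a b < d → Detects Q (errorOp p ω c a b)) ∧
    ∃ (c : ZMod p) (a b : ι → F), quantumWeight a b = d ∧ ¬ Detects Q (errorOp p ω c a b)

/-- `Q` is an `[[n, κ, d]]_q` code, where `n` is the size of `ι` and `q` that of `F`. -/
def IsQuantumCode [DecidableEq ι] [Fintype F] [DecidableEq F]
    (p : ℕ) [Fact p.Prime] [Algebra (ZMod p) F]
    (ω : ℂ) (n κ d : ℕ) (Q : Submodule ℂ (State ι F)) : Prop :=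
  Fintype.card ι = n ∧ Module.finrank ℂ Q = Fintype.card F ^ κ ∧ HasQuantumDistance p ω Q d

/-- `Q` is a stabilizer code obtained by the Hermitian construction from the code `C` over the
quadratic extension `K` of `F`: with respect to a normal basis `β, β ^ q` of `K` over `F`, the
vectors `β a + β ^ q b` of `C` label the operators `X(a) Z(b)`, and `Q` is a joint eigenspace of all
these operators. The eigenvalues `χ` account for the choice of the phases of the stabilizer. -/
def IsHermitianStabilizerCode {K : Type*} [Field K] [Algebra F K] [Fintype F]
    (p : ℕ) [Fact p.Prime] [Algebra (ZMod p) F] (ω : ℂ)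
    (C : Submodule K (ι → K)) (Q : Submodule ℂ (State ι F)) : Prop :=
  ∃ β : K, LinearIndependent F ![β, β ^ Fintype.card F] ∧
    ∃ χ : (ι → F) → (ι → F) → ℂ, ∀ ψ : State ι F,
      ψ ∈ Q ↔ ∀ a b : ι → F,
        (fun i => β * algebraMap F K (a i) + β ^ Fintype.card F * algebraMap F K (b i)) ∈ C →
          opX a (opZ p ω b ψ) = χ a b • ψ

/-- `Q` is a quantum GRL code constructed from the `k`-dimensional Hermitian self-orthogonal GRL
code `C` over `K`. -/
def IsQuantumGRLCode {K : Type*} [Field K] [Algebra F K] [Fintype F]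
    (p : ℕ) [Fact p.Prime] [Algebra (ZMod p) F] (ω : ℂ) {n s : ℕ} (k : ℕ)
    (C : Submodule K (Fin (n + s) → K)) (Q : Submodule ℂ (State (Fin (n + s)) F)) : Prop :=
  IsGRLCode k C ∧ IsHermitianSelfOrthogonal (Fintype.card F) C ∧ IsHermitianStabilizerCode p ω C Q

end Quantum

end QuantumGRL

/-! Write k = r + 3 and take A = diag(d₀, d₁, d₂): codewords are evaluations of polynomials f of
degree < k, followed by multiples of the coefficients of f of degrees r, r + 1, r + 2. Root counting
gives dimension and distance; testing a light dual word against products of linear factors, then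
against monomials, bounds the distance of the dual.

Self-orthogonality is the crux. Let N be the norm from K to F, R a set of q - 1 - m units of F, and
G = ∏ (1 - bX) over b in R. The α's are the m(q + 1) units x with N(x) outside R, and v^(q+1) =
w(N(α)), where w(a) = a^(q-1-r) G(1/a). As w vanishes on R, the Gram sums extend to all of Kˣ and
become power sums; these kill everything except -G_t at i = j = r + t. Taking d_t^(q+1) = G_t
cancels what is left, provided G₀, G₁, G₂ are nonzero (`exists_invRootPoly_coeff_ne_zero`,
`exists_grl_parameters`).

On the quantum side, β a + β^q b turns the antisymmetrized Hermitian form into a nonzero multiple of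
the symplectic form, so C labels commuting operators. A trace computation gives the dimension of a
joint eigenspace, and every undetected error is labelled by a nonzero vector of the Hermitian dual
(`exists_hermitianStabilizerCode`). -/

namespace QuantumGRL

open Polynomial

/-! ### Classical GRL codes with diagonal A: dimension, distances, self-orthogonality. -/

section GRL

variable {K : Type*} [Field K]

/-- The encoder of the code `GRL_k(α, v, diag d)` with `s = 3` and `k = r + 3`: the evaluations
of a polynomial, followed by multiples of its coefficients of degrees `r`, `r + 1`, `r + 2`. -/
noncomputable def grlEncode {n : ℕ} (r : ℕ) (α v : Fin n → K) (d : Fin 3 → K) :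
    K[X] →ₗ[K] (Fin (n + 3) → K) where
  toFun f := Fin.append (fun j => v j * f.eval (α j)) (fun j => d j * f.coeff (r + j))
  map_add' f g := by
    ext j
    refine Fin.addCases (fun i => ?_) (fun i => ?_) j <;> simp [mul_add]
  map_smul' c f := by
    ext j
    refine Fin.addCases (fun i => ?_) (fun i => ?_) j <;> simp [mul_left_comm]

variable {n r : ℕ} {α v : Fin n → K} {d : Fin 3 → K}

@[simp] theorem grlEncode_castAdd (f : K[X]) (j : Fin n) :
    grlEncode r α v d f (Fin.castAdd 3 j) = v j * f.eval (α j) := by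
  simp [grlEncode]

@[simp] theorem grlEncode_natAdd (f : K[X]) (j : Fin 3) :
    grlEncode r α v d f (Fin.natAdd n j) = d j * f.coeff (r + j) := by
  simp [grlEncode]

/-- Row i encodes the monomial X^i; from here on the code is studied as an image of polynomials. -/
theorem grlGenerator_diagonal (i : Fin (r + 3)) :
    grlGenerator (r + 3) α v (Matrix.diagonal d) i = grlEncode r α v d (X ^ (i : ℕ)) := by
  ext j
  refine Fin.addCases (fun l => ?_) (fun l => ?_) j
  · simp [grlGenerator]
  · simp only [grlGenerator, Matrix.of_apply, Fin.addCases_right, grlEncode_natAdd, coeff_X_pow,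
      Matrix.diagonal_apply, Fin.ext_iff]
    split_ifs with h1 h2 h3 h3 h3
    · rw [mul_one]
      congr 1
      ext
      simp only
      omega
    · omega
    · omega
    · simp
    · omega
    · simp

theorem grlCode_diagonal :
    grlCode (r + 3) α v (Matrix.diagonal d) =
      (degreeLT K (r + 3)).map (grlEncode r α v d) := by
  classical
  rw [degreeLT_eq_span_X_pow, Submodule.map_span, grlCode]
  congr 1
  ext c
  simp only [grlGenerator_diagonal, Set.mem_range, Finset.coe_image, Finset.coe_range,
    Set.mem_image, Set.mem_Iio, exists_exists_and_eq_and]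
  exact ⟨fun ⟨i, hi⟩ => ⟨i, i.2, hi⟩, fun ⟨i, h, hi⟩ => ⟨⟨i, h⟩, hi⟩⟩

theorem isGRLCode_diagonal (hn : r + 3 ≤ n) (hα : Function.Injective α) (hv : ∀ i, v i ≠ 0)
    (hd : ∀ i, d i ≠ 0) : IsGRLCode (r + 3) (grlCode (r + 3) α v (Matrix.diagonal d)) := by
  refine ⟨by omega, hn, α, v, Matrix.diagonal d, hα, hv, ?_, rfl⟩
  rw [Matrix.det_diagonal]
  exact (Finset.prod_ne_zero_iff.2 fun i _ => hd i).isUnit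

theorem hammingNorm_append [DecidableEq K] {s : ℕ} (c : Fin (n + s) → K) :
    hammingNorm c = hammingNorm (fun i => c (Fin.castAdd s i)) +
      hammingNorm (fun i => c (Fin.natAdd n i)) := by
  simp only [hammingNorm, Finset.card_filter, Fin.sum_univ_add]

theorem card_le_hammingNorm_eval_add_natDegree [DecidableEq K] (hα : Function.Injective α)
    (hv : ∀ i, v i ≠ 0) {f : K[X]} (hf : f ≠ 0) :
    n ≤ hammingNorm (fun j => v j * f.eval (α j)) + f.natDegree := by
  have h1 : (Finset.univ.filter fun j => f.eval (α j) = 0).card ≤ f.natDegree := by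
    refine le_trans ?_ (f.card_roots' )
    rw [← Finset.card_image_of_injective _ hα]
    refine le_trans (Finset.card_le_card ?_) (Multiset.toFinset_card_le f.roots)
    intro x hx
    simp only [Finset.mem_image, Finset.mem_filter, Finset.mem_univ, true_and] at hx
    obtain ⟨j, hj, rfl⟩ := hx
    simpa [hf] using hj
  have h2 := Finset.card_filter_add_card_filter_not (s := (Finset.univ : Finset (Fin n)))
    (fun j => f.eval (α j) = 0)
  simp only [Finset.card_univ, Fintype.card_fin] at h2
  have h3 : hammingNorm (fun j => v j * f.eval (α j)) =
      (Finset.univ.filter fun j => ¬ f.eval (α j) = 0).card := by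
    simp [hammingNorm, hv]
  omega

theorem minDistanceGE_grlCode [DecidableEq K] (hα : Function.Injective α)
    (hv : ∀ i, v i ≠ 0) (hd : ∀ i, d i ≠ 0) (hn : r + 3 ≤ n) :
    MinDistanceGE (grlCode (r + 3) α v (Matrix.diagonal d)) (n - (r + 3) + 2) := by
  rw [grlCode_diagonal]
  rintro _ ⟨f, hf, rfl⟩ hc
  have hf0 : f ≠ 0 := by
    rintro rfl
    simp at hc
  have hdeg : f.natDegree < r + 3 := (natDegree_lt_iff_degree_lt hf0).2 (mem_degreeLT.1 hf)
  have h1 := card_le_hammingNorm_eval_add_natDegree hα hv hf0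
  rw [hammingNorm_append]
  simp only [grlEncode_castAdd, grlEncode_natAdd]
  -- In top degree f may have one root more than allowed, but then its leading coefficient makes the
  -- last coordinate nonzero.
  by_cases htop : f.natDegree = r + 2
  · have h2 : 0 < hammingNorm (fun i : Fin 3 => d i * f.coeff (r + i)) := by
      rw [hammingNorm_pos_iff]
      intro h
      have h3 := congrFun h 2
      have h4 : f.coeff (r + 2) ≠ 0 := by
        rw [← htop]
        exact leadingCoeff_ne_zero.2 hf0
      exact mul_ne_zero (hd 2) h4 h3
    omega
  · omega

theorem finrank_grlCode (hα : Function.Injective α)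
    (hv : ∀ i, v i ≠ 0) (hn : r + 3 ≤ n) :
    Module.finrank K (grlCode (r + 3) α v (Matrix.diagonal d)) = r + 3 := by
  classical
  rw [grlCode_diagonal]
  have hinj : Function.Injective ((grlEncode r α v d).domRestrict (degreeLT K (r + 3))) := by
    rw [← LinearMap.ker_eq_bot, LinearMap.ker_eq_bot']
    rintro ⟨f, hf⟩ h
    by_contra hne
    have hf0 : f ≠ 0 := fun h0 => hne (Subtype.ext h0)
    have hdeg : f.natDegree < r + 3 := (natDegree_lt_iff_degree_lt hf0).2 (mem_degreeLT.1 hf)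
    have h1 := card_le_hammingNorm_eval_add_natDegree hα hv hf0
    have h2 : (fun j => v j * f.eval (α j)) = 0 := by
      ext j
      have := congrFun h (Fin.castAdd 3 j)
      simpa using this
    rw [h2, hammingNorm_zero] at h1
    omega
  have h3 := LinearMap.finrank_range_of_inj hinj
  rw [LinearMap.range_domRestrict] at h3
  rw [h3, (degreeLTEquiv K (r + 3)).finrank_eq, Module.finrank_fin_fun]

/-- A dual codeword of weight at most `k - 2` vanishes. -/
theorem minDistanceGE_hermitianDual_grlCode [DecidableEq K] {q : ℕ} (hq : q ≠ 0)
    (hα : Function.Injective α) (hv : ∀ i, v i ≠ 0) (hd : ∀ i, d i ≠ 0) :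
    MinDistanceGE (hermitianDual q (grlCode (r + 3) α v (Matrix.diagonal d))) (r + 2) := by
  intro u hu hu0
  by_contra! hlt
  apply hu0
  have key : ∀ f : K[X], f.degree < (r + 3 : ℕ) →
      ∑ j, u (Fin.castAdd 3 j) * (v j * f.eval (α j)) ^ q +
        ∑ j, u (Fin.natAdd n j) * (d j * f.coeff (r + j)) ^ q = 0 := by
    intro f hf
    have h := hu (grlEncode r α v d f) (by
      rw [grlCode_diagonal]
      exact ⟨f, mem_degreeLT.2 hf, rfl⟩)
    rw [Fin.sum_univ_add] at h
    simpa using h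
  rw [hammingNorm_append] at hlt
  set P := Finset.univ.filter fun j : Fin n => u (Fin.castAdd 3 j) ≠ 0 with hP
  have hPc : hammingNorm (fun i => u (Fin.castAdd 3 i)) = P.card := rfl
  have hleft : ∀ l, u (Fin.castAdd 3 l) = 0 := by
    intro l
    by_contra hl
    have hlP : l ∈ P := by simp [hP, hl]
    -- Among the positions where u is nonzero on the left, f vanishes at all but l, so only that
    -- term of the left sum survives.
    set f : K[X] := ∏ j ∈ P.erase l, (X - C (α j)) with hf
    have hfdeg : f.natDegree = P.card - 1 := by
      rw [hf, natDegree_prod_of_monic _ _ fun j _ => monic_X_sub_C _]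
      simp [Finset.card_erase_of_mem hlP]
    have hfne : f ≠ 0 := (monic_prod_of_monic _ _ fun j _ => monic_X_sub_C _).ne_zero
    have hPpos : 0 < P.card := Finset.card_pos.2 ⟨l, hlP⟩
    have h := key f ((natDegree_lt_iff_degree_lt hfne).1 (by omega))
    have h2 : ∑ j, u (Fin.natAdd n j) * (d j * f.coeff (r + j)) ^ q = 0 := by
      refine Finset.sum_eq_zero fun j _ => ?_
      -- Either deg f < r and the tail of the codeword of f is zero, or the r + 1 allowed nonzero
      -- entries of u are all on the left and the tail of u is zero.
      by_cases hr : P.card ≤ r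
      · rw [coeff_eq_zero_of_natDegree_lt (by omega), mul_zero, zero_pow hq, mul_zero]
      · have h3 : hammingNorm (fun i => u (Fin.natAdd n i)) = 0 := by omega
        rw [hammingNorm_eq_zero] at h3
        have h4 := congrFun h3 j
        simp only [Pi.zero_apply] at h4
        rw [h4, zero_mul]
    rw [h2, add_zero, Finset.sum_eq_single l] at h
    · rw [hf, eval_prod] at h
      refine mul_ne_zero hl (pow_ne_zero _ (mul_ne_zero (hv l) ?_)) h
      refine Finset.prod_ne_zero_iff.2 fun j hj => ?_
      simpa [sub_eq_zero] using fun h => (Finset.ne_of_mem_erase hj) (hα h).symm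
    · intro j _ hj
      by_cases hjP : j ∈ P
      · have : f.eval (α j) = 0 := by
          rw [hf, eval_prod]
          exact Finset.prod_eq_zero (Finset.mem_erase.2 ⟨hj, hjP⟩) (by simp)
        rw [this, mul_zero, zero_pow hq, mul_zero]
      · have : u (Fin.castAdd 3 j) = 0 := by simpa [hP] using hjP
        rw [this, zero_mul]
    · simp
  ext j
  refine Fin.addCases hleft (fun l => ?_) j
  have h := key (X ^ (r + (l : ℕ))) (by
    rw [degree_X_pow]
    exact_mod_cast (by omega : r + (l : ℕ) < r + 3))
  simp only [hleft, zero_mul, Finset.sum_const_zero, zero_add, coeff_X_pow] at h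
  rw [Finset.sum_eq_single l] at h
  · simpa [hd] using h
  · intro j _ hj
    rw [if_neg (by omega), mul_zero, zero_pow hq, mul_zero]
  · simp

/-- The form is linear in the first argument and semilinear in the second, since x ↦ x^q is the ring
homomorphism φ; so generators suffice. -/
theorem hermitianSelfOrthogonal_span {ι : Type*} [Fintype ι] {q : ℕ} (φ : K →+* K)
    (hφ : ∀ x, φ x = x ^ q) {S : Set (ι → K)}
    (hS : ∀ u ∈ S, ∀ c ∈ S, ∑ i, u i * c i ^ q = 0) :
    IsHermitianSelfOrthogonal q (Submodule.span K S) := by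
  rw [IsHermitianSelfOrthogonal, Submodule.span_le]
  intro u hu c hc
  simp only [← hφ] at hS ⊢
  induction hc using Submodule.span_induction with
  | mem c hc => exact hS u hu c hc
  | zero => simp
  | add x y _ _ hx hy => simp [mul_add, Finset.sum_add_distrib, hx, hy]
  | smul a x _ hx =>
    simp only [Pi.smul_apply, smul_eq_mul, map_mul, mul_left_comm _ (φ a), ← Finset.mul_sum, hx,
      mul_zero]

/-- The hypothesis is the vanishing of the Gram matrix of the rows; a diagonal tail contributes only
at i = j = r + t. -/
theorem hermitianSelfOrthogonal_grlCode {q : ℕ} (φ : K →+* K) (hφ : ∀ x, φ x = x ^ q)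
    (hq : q ≠ 0)
    (h : ∀ i < r + 3, ∀ j < r + 3, ∑ l, v l ^ (q + 1) * α l ^ (i + q * j) +
      (∑ t : Fin 3, if i = r + t ∧ j = r + t then d t ^ (q + 1) else 0) = 0) :
    IsHermitianSelfOrthogonal q (grlCode (r + 3) α v (Matrix.diagonal d)) := by
  refine hermitianSelfOrthogonal_span φ hφ ?_
  rintro _ ⟨i, rfl⟩ _ ⟨j, rfl⟩
  rw [← h i i.2 j j.2]
  simp only [grlGenerator_diagonal, Fin.sum_univ_add, grlEncode_castAdd, grlEncode_natAdd]
  congr 1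
  · refine Finset.sum_congr rfl fun l _ => ?_
    simp only [eval_pow, eval_X]
    ring
  · refine Finset.sum_congr rfl fun t _ => ?_
    simp only [coeff_X_pow, eq_comm (a := r + (t : ℕ))]
    by_cases h1 : (i : ℕ) = r + t <;> by_cases h2 : (j : ℕ) = r + t <;>
      simp [h1, h2, hq, pow_succ']

end GRL

end QuantumGRL

namespace QuantumGRL

open Polynomial

/-! ### Norms and power sums over finite fields: the choice of α, v and d. -/

section FiniteFields

/-- The polynomial whose roots are the inverses of the elements of `R`. -/
noncomputable def invRootPoly {F : Type*} [Field F] (R : Finset Fˣ) : F[X] :=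
  ∏ b ∈ R, (1 - C (b : F) * X)

section

variable {F : Type*} [Field F]

theorem invRootPoly_coeff_zero (R : Finset Fˣ) : (invRootPoly R).coeff 0 = 1 := by
  simp [invRootPoly, coeff_zero_eq_eval_zero, eval_prod]

theorem natDegree_invRootPoly_le (R : Finset Fˣ) : (invRootPoly R).natDegree ≤ R.card := by
  refine (natDegree_prod_le _ _).trans ?_
  rw [Finset.card_eq_sum_ones]
  refine Finset.sum_le_sum fun b _ => ?_
  refine (natDegree_sub_le _ _).trans ?_
  simp only [natDegree_one, zero_le, sup_of_le_right]
  exact (natDegree_C_mul_le _ _).trans natDegree_X_le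

theorem eval_inv_invRootPoly (R : Finset Fˣ) (a : Fˣ) :
    (invRootPoly R).eval (a : F)⁻¹ = 0 ↔ a ∈ R := by
  rw [invRootPoly, eval_prod, Finset.prod_eq_zero_iff]
  constructor
  · rintro ⟨b, hb, h⟩
    have : a = b := by
      ext
      simp only [eval_sub, eval_one, eval_mul, eval_C, eval_X, sub_eq_zero] at h
      field_simp at h
      exact h
    exact this ▸ hb
  · intro ha
    exact ⟨a, ha, by simp⟩

theorem invRootPoly_insert [DecidableEq F] {R : Finset Fˣ} {b : Fˣ} (hb : b ∉ R) (i : ℕ) :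
    (invRootPoly (insert b R)).coeff (i + 1) =
      (invRootPoly R).coeff (i + 1) - b * (invRootPoly R).coeff i := by
  rw [invRootPoly, Finset.prod_insert hb, ← invRootPoly, sub_mul, one_mul, coeff_sub, mul_assoc,
    coeff_C_mul, coeff_X_mul]

theorem exists_unit_notMem [Fintype F] [DecidableEq F] (R : Finset Fˣ) (S : Finset F)
    (h : R.card + S.card + 1 < Fintype.card F) : ∃ b : Fˣ, b ∉ R ∧ (b : F) ∉ S := by
  have h1 : (insert 0 (R.image Units.val ∪ S)).card < Fintype.card F := by
    refine lt_of_le_of_lt (Finset.card_insert_le _ _) ?_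
    have h2 := Finset.card_union_le (R.image Units.val) S
    have h3 := Finset.card_image_le (s := R) (f := Units.val)
    omega
  obtain ⟨x, hx⟩ : ∃ x, x ∉ insert 0 (R.image Units.val ∪ S) := by
    by_contra! h2
    rw [Finset.eq_univ_iff_forall.2 h2, Finset.card_univ] at h1
    omega
  simp only [Finset.mem_insert, Finset.mem_union, Finset.mem_image, not_or] at hx
  exact ⟨Units.mk0 x hx.1, fun hb => hx.2.1 ⟨_, hb, rfl⟩, hx.2.2⟩

/-- There are sets of units of every size between `2` and `q - 3` whose first two elementary
symmetric functions do not vanish. -/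
theorem exists_invRootPoly_coeff_ne_zero [Fintype F] {r : ℕ} (hr : r + 5 ≤ Fintype.card F) :
    ∃ R : Finset Fˣ, R.card = r + 2 ∧ (invRootPoly R).coeff 1 ≠ 0 ∧
      (invRootPoly R).coeff 2 ≠ 0 := by
  classical
  have hle : r ≤ (Finset.univ : Finset Fˣ).card := by
    rw [Finset.card_univ, Fintype.card_units]
    omega
  obtain ⟨R₀, -, hR₀⟩ := Finset.exists_subset_card_eq hle
  -- Inserting b subtracts b from the coefficient of X, so one value is forbidden.
  obtain ⟨b, hb, hb1⟩ := exists_unit_notMem R₀ {(invRootPoly R₀).coeff 1} (by simp; omega)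
  have hR₁ := Finset.card_insert_of_notMem hb
  set R₁ := insert b R₀ with hR₁def
  have h1 : (invRootPoly R₁).coeff 1 ≠ 0 := by
    rw [hR₁def, invRootPoly_insert hb 0, invRootPoly_coeff_zero, mul_one, sub_ne_zero]
    simpa using fun h => hb1 (by simp [← h])
  -- Inserting c turns the coefficients g₁, g₂ into g₁ - c and g₂ - c g₁; hence the two forbidden
  -- values.
  obtain ⟨c, hc, hc1⟩ := exists_unit_notMem R₁ {(invRootPoly R₁).coeff 1,
    (invRootPoly R₁).coeff 2 / (invRootPoly R₁).coeff 1} (by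
      have := Finset.card_le_two (a := (invRootPoly R₁).coeff 1)
        (b := (invRootPoly R₁).coeff 2 / (invRootPoly R₁).coeff 1)
      omega)
  simp only [Finset.mem_insert, Finset.mem_singleton, not_or, eq_div_iff h1] at hc1
  refine ⟨insert c R₁, by rw [Finset.card_insert_of_notMem hc]; omega, ?_, ?_⟩
  · rw [invRootPoly_insert hc 0, invRootPoly_coeff_zero, mul_one, sub_ne_zero]
    exact fun h => hc1.1 h.symm
  · rw [invRootPoly_insert hc 1, sub_ne_zero]
    exact fun h => hc1.2 h.symm

end

/-- Modulo q + 1 the exponent is i - j, too small to be a nonzero multiple, so i = j. Dividing by q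
+ 1 leaves q - 1 dividing q - 1 - r - t + i, which lies strictly between 0 and 2(q - 1). -/
theorem sq_sub_one_dvd_iff {q r t i j : ℕ} (hq : 5 ≤ q) (ht : r + t + 1 < q)
    (hi : i < r + 3) (hj : j < r + 3) (hr : r + 4 ≤ q) :
    q ^ 2 - 1 ∣ (q + 1) * (q - 1 - r - t) + (i + q * j) ↔ i = r + t ∧ j = r + t := by
  have hfac : q ^ 2 - 1 = (q + 1) * (q - 1) := by
    simpa using Nat.sq_sub_sq q 1
  rw [hfac]
  constructor
  · intro h
    have h1 : q + 1 ∣ i + q * j :=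
      (Nat.dvd_add_right (Dvd.intro _ rfl)).1 ((Dvd.intro _ rfl).trans h)
    have hij : i = j := by
      have h2 : ((q + 1 : ℕ) : ℤ) ∣ (i : ℤ) - j := by
        have h3 : (i : ℤ) - j = ((i + q * j : ℕ) : ℤ) - ((q + 1 : ℕ) : ℤ) * j := by
          push_cast
          ring
        rw [h3]
        exact dvd_sub (Int.natCast_dvd_natCast.2 h1) (Dvd.intro _ rfl)
      have h4 := Int.eq_zero_of_abs_lt_dvd h2 (by rw [abs_lt]; constructor <;> push_cast <;> omega)
      omega
    subst hij
    have h5 : (q + 1) * (q - 1 - r - t) + (i + q * i) = (q + 1) * (q - 1 - r - t + i) := by ring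
    rw [h5] at h
    obtain ⟨c, hc⟩ := Nat.dvd_of_mul_dvd_mul_left (by omega) h
    have hc1 : c = 1 := by
      have hc0 : c ≠ 0 := by
        rintro rfl
        omega
      by_contra hne
      have : (q - 1) * 2 ≤ (q - 1) * c := Nat.mul_le_mul_left _ (by omega)
      omega
    subst hc1
    omega
  · rintro ⟨rfl, rfl⟩
    refine ⟨1, ?_⟩
    obtain ⟨c, rfl⟩ : ∃ c, q = c + 1 + r + t := ⟨q - 1 - r - t, by omega⟩
    rw [show c + 1 + r + t - 1 - r - t = c by omega, show c + 1 + r + t - 1 = c + r + t by omega]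
    ring

variable {F K : Type*} [Field F] [Field K] [Fintype F] [Fintype K] [Algebra F K] {q : ℕ}

theorem algebraMap_norm_eq_pow_succ (hF : Fintype.card F = q) (hK : Fintype.card K = q ^ 2)
    (x : K) : algebraMap F K (Algebra.norm F x) = x ^ (q + 1) := by
  have hq : 1 < q := hF ▸ Fintype.one_lt_card
  rw [FiniteField.algebraMap_norm_eq_pow, Nat.card_eq_fintype_card, Nat.card_eq_fintype_card, hF,
    hK]
  congr 1
  rw [show q ^ 2 - 1 = (q + 1) * (q - 1) by simpa using Nat.sq_sub_sq q 1]
  exact Nat.mul_div_cancel _ (by omega)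

/-- The norm is a surjective homomorphism on units, so its fibres all have the same size; counting
Kˣ shows that it is q + 1. -/
theorem card_norm_notMem (hF : Fintype.card F = q) (hK : Fintype.card K = q ^ 2)
    (R : Finset Fˣ) [DecidableEq F] [DecidableEq K] :
    Fintype.card {x : Kˣ // Units.map (Algebra.norm F) x ∉ R} = (q - 1 - R.card) * (q + 1) := by
  have hq : 1 < q := hF ▸ Fintype.one_lt_card
  have hN := FiniteField.unitsMap_norm_surjective F K
  set N := Units.map (Algebra.norm F (S := K)) with hNdef
  have hfib : ∀ a : Fˣ, (Finset.univ.filter fun x => N x = a).card =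
      (Finset.univ.filter fun x => N x = 1).card := fun a =>
    MonoidHom.card_fiber_eq_of_mem_range N (hN a) (hN 1)
  have hcount : ∀ S : Finset Fˣ, (Finset.univ.filter fun x => N x ∈ S).card =
      S.card * (Finset.univ.filter fun x => N x = 1).card := by
    intro S
    rw [Finset.card_eq_sum_card_fiberwise (f := N) (t := S) (by intro x; simp),
      Finset.sum_congr rfl (g := fun _ => (Finset.univ.filter fun x => N x = 1).card),
      Finset.sum_const, smul_eq_mul]
    intro a ha
    rw [← hfib a, Finset.filter_filter]
    congr 1
    ext x
    simp only [Finset.mem_filter, Finset.mem_univ, true_and, and_iff_right_iff_imp]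
    rintro rfl
    exact ha
  have hker : (Finset.univ.filter fun x => N x = 1).card = q + 1 := by
    have h := hcount Finset.univ
    simp only [Finset.mem_univ, Finset.filter_true, Finset.card_univ, Fintype.card_units, hF,
      hK] at h
    rw [show q ^ 2 - 1 = (q - 1) * (q + 1) by
      rw [mul_comm]; simpa using Nat.sq_sub_sq q 1] at h
    exact (Nat.eq_of_mul_eq_mul_left (by omega) h).symm
  have h := hcount Rᶜ
  rw [hker, Finset.card_compl, Fintype.card_units, hF] at h
  rw [Fintype.card_subtype, ← h]
  simp

theorem exists_grl_parameters (hF : Fintype.card F = q) (hK : Fintype.card K = q ^ 2)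
    {m r : ℕ} (hm : 2 ≤ m) (hmq : m + 3 ≤ q) (hr : r + 1 ≤ m) :
    ∃ (α v : Fin (m * (q + 1)) → K) (d : Fin 3 → K), Function.Injective α ∧ (∀ i, v i ≠ 0) ∧
      (∀ i, d i ≠ 0) ∧ ∀ i < r + 3, ∀ j < r + 3, ∑ l, v l ^ (q + 1) * α l ^ (i + q * j) +
      (∑ t : Fin 3, if i = r + t ∧ j = r + t then d t ^ (q + 1) else 0) = 0 := by
  classical
  -- This gives |R| = q - 1 - m, leaving m norm classes; the size bound needed is m ≥ 2.
  obtain ⟨R, hRc, hR1, hR2⟩ := exists_invRootPoly_coeff_ne_zero (F := F) (r := q - 3 - m)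
    (by omega)
  set G := invRootPoly R with hG
  have hdeg : G.natDegree < q - m := lt_of_le_of_lt (natDegree_invRootPoly_le R) (by omega)
  -- Since r + 1 ≤ m, the truncated subtraction in the exponent is genuine, and w(a) = a^(q-1-r)
  -- G(1/a) on units.
  let w : F → F := fun a => ∑ t ∈ Finset.range (q - m), G.coeff t * a ^ (q - 1 - r - t)
  have hw : ∀ a : Fˣ, w a = 0 ↔ a ∈ R := by
    intro a
    rw [← eval_inv_invRootPoly, ← hG]
    have : w a = (a : F) ^ (q - 1 - r) * G.eval (a : F)⁻¹ := by
      rw [eval_eq_sum_range' hdeg, Finset.mul_sum]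
      refine Finset.sum_congr rfl fun t ht => ?_
      have ht' := Finset.mem_range.1 ht
      rw [pow_sub₀ _ a.ne_zero (by omega : t ≤ q - 1 - r), inv_pow]
      ring
    rw [this]
    simp
  have hroot : ∀ a : F, ∃ x : K, x ^ (q + 1) = algebraMap F K a := fun a => by
    obtain ⟨x, hx⟩ := FiniteField.norm_surjective F K a
    exact ⟨x, by rw [← hx, algebraMap_norm_eq_pow_succ hF hK]⟩
  choose root hrootpow using hroot
  have hroot0 : ∀ a, a ≠ 0 → root a ≠ 0 := fun a ha h => by
    have := hrootpow a
    rw [h, zero_pow (by omega), eq_comm, map_eq_zero] at this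
    exact ha this
  let N := Units.map (Algebra.norm F (S := K))
  let T := {x : Kˣ // N x ∉ R}
  have hT : Fintype.card T = m * (q + 1) := by
    rw [card_norm_notMem hF hK R, hRc]
    congr 1
    omega
  let e : Fin (m * (q + 1)) ≃ T := (Fintype.equivFinOfCardEq hT).symm
  refine ⟨fun l => (e l).1, fun l => root (w (N (e l).1)), fun t => root (G.coeff t), ?_, ?_, ?_,
    ?_⟩
  · intro l l' h
    exact e.injective (Subtype.ext (Units.ext h))
  · intro l
    exact hroot0 _ fun h => (e l).2 ((hw _).1 h)
  · intro t
    refine hroot0 _ ?_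
    fin_cases t
    · simp [hG, invRootPoly_coeff_zero]
    · exact hR1
    · exact hR2
  · intro i hi j hj
    have hsum : ∑ l, root (w (N (e l).1)) ^ (q + 1) * ((e l).1 : K) ^ (i + q * j) =
        ∑ t ∈ Finset.range (q - m), algebraMap F K (G.coeff t) *
          if i = r + t ∧ j = r + t then -1 else 0 := by
      rw [e.sum_comp fun x : T => root (w (N x.1)) ^ (q + 1) * ((x.1 : Kˣ) : K) ^ (i + q * j)]
      -- The excluded units contribute nothing because w vanishes on R.
      have h1 : ∑ x : T, root (w (N x.1)) ^ (q + 1) * ((x.1 : Kˣ) : K) ^ (i + q * j) =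
          ∑ x : Kˣ, algebraMap F K (w (N x)) * (x : K) ^ (i + q * j) := by
        simp only [hrootpow]
        rw [← Finset.sum_subtype (Finset.univ.filter fun x => N x ∉ R) (by simp)
          (fun x : Kˣ => algebraMap F K (w (N x)) * (x : K) ^ (i + q * j))]
        refine Finset.sum_subset (Finset.filter_subset _ _) fun x _ hx => ?_
        have hx' : N x ∈ R := by simpa using hx
        rw [(hw _).2 hx', map_zero, zero_mul]
      rw [h1]
      have h2 : ∀ x : Kˣ, algebraMap F K (w (N x)) * (x : K) ^ (i + q * j) =
          ∑ t ∈ Finset.range (q - m), algebraMap F K (G.coeff t) *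
            (x : K) ^ ((q + 1) * (q - 1 - r - t) + (i + q * j)) := by
        intro x
        rw [map_sum, Finset.sum_mul]
        refine Finset.sum_congr rfl fun t _ => ?_
        rw [map_mul, map_pow, Units.coe_map, algebraMap_norm_eq_pow_succ hF hK,
          ← pow_mul, pow_add _ _ (i + q * j), mul_assoc]
      simp only [h2]
      rw [Finset.sum_comm]
      refine Finset.sum_congr rfl fun t ht => ?_
      have ht' := Finset.mem_range.1 ht
      rw [← Finset.mul_sum, FiniteField.sum_pow_units, hK]
      simp only [sq_sub_one_dvd_iff (q := q) (r := r) (t := t) (by omega) (by omega) hi hj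
        (by omega)]
    rw [hsum]
    simp only [hrootpow]
    by_cases hij : i = j ∧ r ≤ i
    · obtain ⟨rfl, hri⟩ := hij
      obtain ⟨s, rfl⟩ := Nat.exists_eq_add_of_le hri
      have hs : s < 3 := by omega
      -- All three indices s < 3 occur in the range of t because m + 3 ≤ q.
      rw [Finset.sum_eq_single_of_mem s (Finset.mem_range.2 (by omega)),
        Finset.sum_eq_single_of_mem (⟨s, hs⟩ : Fin 3) (Finset.mem_univ _)]
      · simp
      · intro t _ hne
        rw [if_neg]
        rintro ⟨h, -⟩
        exact hne (Fin.ext (by simp only; omega))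
      · intro t _ hne
        rw [if_neg (by omega), mul_zero]
    · rw [Finset.sum_eq_zero, Finset.sum_eq_zero, add_zero]
      · intro t _
        rw [if_neg (by omega)]
      · intro t _
        rw [if_neg (by omega), mul_zero]

end FiniteFields

end QuantumGRL

namespace QuantumGRL

open Matrix

/-! ### Weyl operators: commutation, unitarity, traces, joint eigenvectors. -/

section Weyl

variable {ι F : Type*} [Fintype ι] [Field F]

/-- The additive character `x ↦ ω ^ Tr x` of a finite field. -/
noncomputable def traceChar (F : Type*) [Field F] {p : ℕ} [Fact p.Prime] [Algebra (ZMod p) F]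
    {ω : ℂ} (hω : IsPrimitiveRoot ω p) : AddChar F ℂ :=
  (AddChar.zmodChar p hω.pow_eq_one).compAddMonoidHom
    (Algebra.trace (ZMod p) F).toAddMonoidHom

variable {p : ℕ} [Fact p.Prime] [Algebra (ZMod p) F] {ω : ℂ} (hω : IsPrimitiveRoot ω p)

theorem traceChar_apply (x : F) :
    traceChar F hω x = ω ^ (Algebra.trace (ZMod p) F x).val := rfl

theorem traceChar_ne_zero (x : F) : traceChar F hω x ≠ 0 :=
  pow_ne_zero _ (hω.ne_zero (NeZero.ne p))

theorem exists_traceChar_mul_ne_one [Finite F] {a : F} (ha : a ≠ 0) :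
    ∃ b, traceChar F hω (a * b) ≠ 1 := by
  have htr := (traceForm_nondegenerate (ZMod p) F).1 a
  simp_rw [Algebra.traceForm_apply] at htr
  by_contra! hf
  refine ha (htr fun y => ?_)
  have h := hf y
  rw [traceChar_apply, ← pow_zero ω] at h
  exact (ZMod.val_eq_zero _).1 (hω.pow_inj (ZMod.val_lt _) (NeZero.pos _) h)

theorem sum_traceChar_dotProduct [Fintype F] [DecidableEq ι] {b : ι → F} (hb : b ≠ 0) :
    ∑ x : ι → F, traceChar F hω (b ⬝ᵥ x) = 0 := by
  classical
  obtain ⟨i, hi⟩ : ∃ i, b i ≠ 0 := by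
    by_contra! h
    exact hb (funext h)
  obtain ⟨y, hy⟩ := exists_traceChar_mul_ne_one hω hi
  let ψ : AddChar (ι → F) ℂ := (traceChar F hω).compAddMonoidHom
    { toFun := fun x => b ⬝ᵥ x
      map_zero' := dotProduct_zero b
      map_add' := dotProduct_add b }
  have hψ : ψ ≠ 0 := by
    intro h
    have h1 : ψ (Pi.single i y) = 1 := by rw [h]; rfl
    apply hy
    have h2 : ψ (Pi.single i y) = traceChar F hω (b ⬝ᵥ Pi.single i y) := rfl
    rwa [h2, dotProduct_single] at h1
  have h := ψ.sum_eq_ite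
  rw [if_neg hψ] at h
  exact h

/-- The operator `X(a) Z(b)` labelled by `c = (a, b)`. -/
noncomputable def weylOp (p : ℕ) [Fact p.Prime] [Algebra (ZMod p) F] (ω : ℂ)
    (c : (ι → F) × (ι → F)) : Module.End ℂ (State ι F) :=
  opX c.1 ∘ₗ opZ p ω c.2

/-- The symplectic form on labels of error operators. -/
def symplecticForm (c g : (ι → F) × (ι → F)) : F :=
  c.2 ⬝ᵥ g.1 - g.2 ⬝ᵥ c.1

theorem weylOp_apply (c : (ι → F) × (ι → F)) (ψ : State ι F) (x : ι → F) :
    weylOp p ω c ψ x = traceChar F hω (c.2 ⬝ᵥ (x - c.1)) * ψ (x - c.1) := by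
  have h : traceChar F hω (c.2 ⬝ᵥ (x - c.1)) =
      ∏ i, traceChar F hω (c.2 i * (x - c.1) i) :=
    map_prod (traceChar F hω).toMonoidHom
      (fun i => Multiplicative.ofAdd (c.2 i * (x - c.1) i)) Finset.univ
  rw [h]
  rfl

theorem weylOp_mul (c g : (ι → F) × (ι → F)) :
    weylOp p ω c * weylOp p ω g = traceChar F hω (c.2 ⬝ᵥ g.1) • weylOp p ω (c + g) := by
  ext ψ x
  rw [Module.End.mul_apply, LinearMap.smul_apply, PiLp.smul_apply, weylOp_apply hω,
    weylOp_apply hω, weylOp_apply hω, smul_eq_mul, ← mul_assoc, ← mul_assoc,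
    ← AddChar.map_add_eq_mul, ← AddChar.map_add_eq_mul, Prod.fst_add, Prod.snd_add, sub_sub]
  congr 2
  simp only [dotProduct_sub, dotProduct_add, add_dotProduct]
  ring

theorem weylOp_zero (hω : IsPrimitiveRoot ω p) :
    weylOp p ω (0 : (ι → F) × (ι → F)) = 1 := by
  ext ψ x
  rw [weylOp_apply hω]
  simp

theorem weylOp_mul_comm (c g : (ι → F) × (ι → F)) :
    weylOp p ω c * weylOp p ω g =
      traceChar F hω (symplecticForm c g) • (weylOp p ω g * weylOp p ω c) := by
  rw [weylOp_mul hω, weylOp_mul hω, smul_smul, ← AddChar.map_add_eq_mul, add_comm g c]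
  congr 2
  simp [symplecticForm]

theorem exists_weylOp_pow (hω : IsPrimitiveRoot ω p) (c : (ι → F) × (ι → F)) (n : ℕ) :
    ∃ s : ℂ, s ≠ 0 ∧ weylOp p ω c ^ n = s • weylOp p ω (n • c) := by
  induction n with
  | zero => exact ⟨1, one_ne_zero, by simp [weylOp_zero hω]⟩
  | succ n ih =>
    obtain ⟨s, hs, h⟩ := ih
    refine ⟨s * traceChar F hω ((n • c).2 ⬝ᵥ c.1), mul_ne_zero hs (traceChar_ne_zero hω _), ?_⟩
    rw [pow_succ, h, smul_mul_assoc, weylOp_mul hω, smul_smul, succ_nsmul]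

/-- Labels are p-torsion, so the p-th power of the operator is a nonzero scalar s, and X^p - s is
separable over ℂ. -/
theorem weylOp_isSemisimple (hω : IsPrimitiveRoot ω p) (c : (ι → F) × (ι → F)) [Fintype F]
    [DecidableEq ι] :
    (weylOp p ω c).IsSemisimple := by
  obtain ⟨s, hs, h⟩ := exists_weylOp_pow hω c p
  have hp : p • c = 0 := by
    have : CharP F p := charP_of_injective_algebraMap (algebraMap (ZMod p) F).injective p
    ext i <;> simp
  rw [hp, weylOp_zero hω] at h
  refine Module.End.isSemisimple_of_squarefree_aeval_eq_zero
    (p := Polynomial.X ^ p - Polynomial.C s) ?_ ?_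
  · exact (Polynomial.separable_X_pow_sub_C s
      (Nat.cast_ne_zero.2 (Fact.out : p.Prime).ne_zero) hs).squarefree
  · simp [h, Algebra.algebraMap_eq_smul_one]

theorem inner_weylOp [Fintype F] [DecidableEq ι] (hω : IsPrimitiveRoot ω p)
    (c : (ι → F) × (ι → F)) (φ ψ : State ι F) :
    inner ℂ (weylOp p ω c φ) (weylOp p ω c ψ) = inner ℂ φ ψ := by
  simp only [PiLp.inner_apply, weylOp_apply hω, ← smul_eq_mul (a := traceChar F hω _),
    inner_smul_left, inner_smul_right]
  rw [← (Equiv.subRight c.1).sum_comp fun x => inner ℂ (φ x) (ψ x)]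
  refine Finset.sum_congr rfl fun x _ => ?_
  rw [← smul_mul_assoc, smul_eq_mul,
    Complex.mul_conj, Complex.normSq_eq_norm_sq, AddChar.norm_apply]
  simp

/-- A nonzero shift leaves no diagonal entries; without a shift, the trace is a sum of a nontrivial
character. -/
theorem trace_weylOp [Fintype F] [DecidableEq ι] [DecidableEq F] (hω : IsPrimitiveRoot ω p)
    {c : (ι → F) × (ι → F)} (hc : c ≠ 0) :
    LinearMap.trace ℂ (State ι F) (weylOp p ω c) = 0 := by
  rw [LinearMap.trace_eq_sum_inner _ (EuclideanSpace.basisFun (ι → F) ℂ)]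
  simp only [EuclideanSpace.basisFun_apply, EuclideanSpace.inner_single_left, weylOp_apply hω,
    map_one, one_mul]
  by_cases ha : c.1 = 0
  · have hb : c.2 ≠ 0 := fun hb => hc (Prod.ext ha hb)
    simp [ha, sum_traceChar_dotProduct hω hb]
  · refine Finset.sum_eq_zero fun x _ => ?_
    simp [ha]

/-- The operators commute, so joint generalized eigenspaces span the space and one is nonzero;
semisimplicity makes its vectors true eigenvectors. -/
theorem exists_joint_eigenvector [Fintype F] [DecidableEq ι] (hω : IsPrimitiveRoot ω p)
    (L : AddSubgroup ((ι → F) × (ι → F)))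
    (hL : ∀ c ∈ L, ∀ g ∈ L, symplecticForm c g = 0) :
    ∃ (χ : (ι → F) × (ι → F) → ℂ) (ψ : State ι F), ψ ≠ 0 ∧
      ∀ c ∈ L, weylOp p ω c ψ = χ c • ψ := by
  classical
  have htop := Module.End.iSup_iInf_maxGenEigenspace_eq_top_of_iSup_maxGenEigenspace_eq_top_of_commute
    (fun c : L => weylOp p ω c.1) (fun c g _ => by
      change _ * _ = _ * _
      rw [weylOp_mul_comm hω, hL _ c.2 _ g.2, AddChar.map_zero_eq_one, one_smul])
    (fun c => Module.End.iSup_maxGenEigenspace_eq_top _)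
  obtain ⟨χ, hχ⟩ : ∃ χ : L → ℂ, ⨅ c : L, (weylOp p ω c.1).maxGenEigenspace (χ c) ≠ ⊥ := by
    by_contra! h
    simp only [h, iSup_bot] at htop
    exact bot_ne_top htop
  obtain ⟨ψ, hψ, hψ0⟩ := Submodule.exists_mem_ne_zero_of_ne_bot hχ
  refine ⟨fun c => if h : c ∈ L then χ ⟨c, h⟩ else 0, ψ, hψ0, fun c hc => ?_⟩
  have h := (Submodule.mem_iInf _).1 hψ ⟨c, hc⟩
  rw [(weylOp_isSemisimple hω c).isFinitelySemisimple.maxGenEigenspace_eq_eigenspace,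
    Module.End.mem_eigenspace_iff] at h
  simpa only [dif_pos hc] using h

end Weyl

end QuantumGRL

namespace QuantumGRL

open Matrix

/-! ### Stabilizer codes: dimension, detection of errors, minimum distance. -/

section Stabilizer

variable {ι F : Type*} [Fintype ι] [Field F] {p : ℕ} [Fact p.Prime] [Algebra (ZMod p) F] {ω : ℂ}

/-- The joint eigenspace of the operators labelled by `L` with eigenvalues `χ`. -/
noncomputable def jointEigenspace (p : ℕ) [Fact p.Prime] [Algebra (ZMod p) F] (ω : ℂ)
    (L : AddSubgroup ((ι → F) × (ι → F))) (χ : (ι → F) × (ι → F) → ℂ) :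
    Submodule ℂ (State ι F) :=
  ⨅ c ∈ L, (weylOp p ω c).eigenspace (χ c)

theorem mem_jointEigenspace {L : AddSubgroup ((ι → F) × (ι → F))}
    {χ : (ι → F) × (ι → F) → ℂ} {ψ : State ι F} :
    ψ ∈ jointEigenspace p ω L χ ↔ ∀ c ∈ L, weylOp p ω c ψ = χ c • ψ := by
  simp [jointEigenspace, Submodule.mem_iInf]

theorem errorOp_eq (c : ZMod p) (g : (ι → F) × (ι → F)) :
    errorOp p ω c g.1 g.2 = ω ^ c.val • weylOp p ω g := rfl

variable [Fintype F] [DecidableEq ι]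

/-- The dimension of a nonzero joint eigenspace is the dimension of the state space divided by
the order of the stabilizer. -/
theorem finrank_jointEigenspace_mul_card [DecidableEq F] (hω : IsPrimitiveRoot ω p)
    {L : AddSubgroup ((ι → F) × (ι → F))} {χ : (ι → F) × (ι → F) → ℂ} {ψ : State ι F}
    (hψ0 : ψ ≠ 0) (hψ : ψ ∈ jointEigenspace p ω L χ) :
    Module.finrank ℂ (jointEigenspace p ω L χ) * Nat.card L =
      Fintype.card F ^ Fintype.card ι := by
  classical
  rw [mem_jointEigenspace] at hψ
  have hχ0 : χ 0 = 1 := by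
    have h := hψ 0 L.zero_mem
    rw [weylOp_zero hω, Module.End.one_apply] at h
    have h2 : (χ 0 - 1) • ψ = 0 := by rw [sub_smul, one_smul, ← h, sub_self]
    exact sub_eq_zero.1 ((smul_eq_zero.1 h2).resolve_right hψ0)
  have hχmul : ∀ c ∈ L, ∀ g ∈ L,
      χ c * χ g = traceChar F hω (c.2 ⬝ᵥ g.1) * χ (c + g) := by
    intro c hc g hg
    have h := LinearMap.congr_fun (weylOp_mul hω c g) ψ
    rw [Module.End.mul_apply, LinearMap.smul_apply, hψ g hg, map_smul, hψ c hc,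
      hψ _ (L.add_mem hc hg), smul_smul, smul_smul, mul_comm (χ g)] at h
    exact smul_left_injective ℂ hψ0 h
  have hχne : ∀ c ∈ L, χ c ≠ 0 := by
    intro c hc h
    have h1 := hχmul c hc (-c) (L.neg_mem hc)
    rw [h, zero_mul, add_neg_cancel, hχ0, mul_one] at h1
    exact traceChar_ne_zero hω _ h1.symm
  -- On L the eigenvalues satisfy the same cocycle relation as the operators, so rescaling gives a
  -- genuine representation whose invariants are the code. The averaging projection has the code's
  -- dimension as trace, and only the identity contributes.
  let ρ : Representation ℂ (Multiplicative L) (State ι F) :=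
    { toFun := fun c => (χ c.toAdd.1)⁻¹ • weylOp p ω c.toAdd.1
      map_one' := by simp [hχ0, weylOp_zero hω]
      map_mul' := by
        intro c g
        have h := hχmul _ c.toAdd.2 _ g.toAdd.2
        have h1 := hχne _ (L.add_mem c.toAdd.2 g.toAdd.2)
        rw [smul_mul_smul_comm, weylOp_mul hω, smul_smul, ← mul_inv, h, toAdd_mul,
          AddSubgroup.coe_add]
        congr 1
        have h2 := traceChar_ne_zero hω (c.toAdd.1.2 ⬝ᵥ g.toAdd.1.1)
        field_simp }
  have hρ : ∀ c, ρ c = (χ c.toAdd.1)⁻¹ • weylOp p ω c.toAdd.1 := fun _ => rfl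
  have hinv : ρ.invariants = jointEigenspace p ω L χ := by
    ext φ
    rw [Representation.mem_invariants, mem_jointEigenspace]
    constructor
    · intro h c hc
      have h1 := h (Multiplicative.ofAdd ⟨c, hc⟩)
      rw [hρ, LinearMap.smul_apply] at h1
      exact (inv_smul_eq_iff₀ (hχne c hc)).1 h1
    · intro h c
      rw [hρ, LinearMap.smul_apply]
      exact (inv_smul_eq_iff₀ (hχne _ c.toAdd.2)).2 (h _ c.toAdd.2)
  have hcard0 : (Fintype.card (Multiplicative L) : ℂ) ≠ 0 :=
    Nat.cast_ne_zero.2 Fintype.card_ne_zero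
  let : Invertible (Fintype.card (Multiplicative L) : ℂ) := invertibleOfNonzero hcard0
  have htr := (Representation.isProj_averageMap ρ).trace
  have hsum : LinearMap.trace ℂ (State ι F) ρ.averageMap =
      (Fintype.card (Multiplicative L) : ℂ)⁻¹ * (Fintype.card F ^ Fintype.card ι : ℕ) := by
    have h1 : ρ.averageMap = (Fintype.card (Multiplicative L) : ℂ)⁻¹ • ∑ c, ρ c := by
      simp [GroupAlgebra.average]
    rw [h1, map_smul, map_sum, Finset.sum_eq_single 1, smul_eq_mul, map_one, LinearMap.trace_one]
    · simp
    · intro c _ hc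
      rw [hρ, map_smul, trace_weylOp hω, smul_zero]
      intro h
      exact hc (congrArg Multiplicative.ofAdd (Subtype.ext h : c.toAdd = 0))
    · simp
  rw [hsum, hinv] at htr
  have hc : Nat.card L = Fintype.card (Multiplicative L) := by
    rw [Nat.card_eq_fintype_card]
    exact Fintype.card_congr Multiplicative.ofAdd
  rw [hc]
  have : (Module.finrank ℂ (jointEigenspace p ω L χ) : ℂ) * Fintype.card (Multiplicative L) =
      (Fintype.card F ^ Fintype.card ι : ℕ) := by
    rw [← htr, mul_comm, mul_inv_cancel_left₀ hcard0]
  exact_mod_cast this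

/-- An error whose label is not symplectic orthogonal to the stabilizer maps the code to its
orthogonal complement. -/
theorem inner_weylOp_eq_zero (hω : IsPrimitiveRoot ω p)
    {L : AddSubgroup ((ι → F) × (ι → F))} {χ : (ι → F) × (ι → F) → ℂ}
    {c g : (ι → F) × (ι → F)} (hc : c ∈ L) (hcg : traceChar F hω (symplecticForm c g) ≠ 1)
    {φ ψ : State ι F} (hφ : φ ∈ jointEigenspace p ω L χ) (hψ : ψ ∈ jointEigenspace p ω L χ) :
    inner ℂ φ (weylOp p ω g ψ) = 0 := by
  rw [mem_jointEigenspace] at hφ hψ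
  by_cases hφ0 : φ = 0
  · rw [hφ0, inner_zero_left]
  -- Unitarity makes χ(c) unimodular. Applying the operator of c to both arguments then multiplies
  -- the inner product by a phase different from 1, so it vanishes.
  have h1 : starRingEnd ℂ (χ c) * χ c = 1 := by
    have h := inner_weylOp hω c φ φ
    rw [hφ c hc, inner_smul_left, inner_smul_right, ← mul_assoc] at h
    exact mul_right_cancel₀ (inner_self_ne_zero.2 hφ0) (h.trans (one_mul _).symm)
  have h2 : weylOp p ω c (weylOp p ω g ψ) =
      (traceChar F hω (symplecticForm c g) * χ c) • weylOp p ω g ψ := by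
    have h := LinearMap.congr_fun (weylOp_mul_comm hω c g) ψ
    rwa [Module.End.mul_apply, LinearMap.smul_apply, Module.End.mul_apply, hψ c hc, map_smul,
      smul_smul] at h
  have h3 := inner_weylOp hω c φ (weylOp p ω g ψ)
  rw [h2, hφ c hc, inner_smul_left, inner_smul_right] at h3
  by_contra hne
  apply hcg
  apply mul_right_cancel₀ hne
  linear_combination h3 - traceChar F hω (symplecticForm c g) * inner ℂ φ (weylOp p ω g ψ) * h1

/-- No code of dimension at least two detects all errors. -/
theorem exists_not_detects [DecidableEq F] (hω : IsPrimitiveRoot ω p) {Q : Submodule ℂ (State ι F)}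
    (hQ : 2 ≤ Module.finrank ℂ Q) :
    ∃ (c : ZMod p) (a b : ι → F), ¬ Detects Q (errorOp p ω c a b) := by
  by_contra! hdet
  let B := stdOrthonormalBasis ℂ Q
  let i₀ : Fin (Module.finrank ℂ Q) := ⟨0, by omega⟩
  let i₁ : Fin (Module.finrank ℂ Q) := ⟨1, by omega⟩
  have hne : i₀ ≠ i₁ := by simp [i₀, i₁]
  have horth : inner ℂ (B i₀ : State ι F) (B i₁ : State ι F) = 0 := B.orthonormal.2 hne
  have hnz : ∀ i, ∃ x, (B i : State ι F) x ≠ 0 := by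
    intro i
    by_contra! h
    exact B.orthonormal.ne_zero i (Subtype.ext (by ext x; exact h x))
  have hinner : ∀ a b : ι → F,
      inner ℂ (B i₀ : State ι F) (weylOp p ω (a, b) (B i₁ : State ι F)) = 0 := by
    intro a b
    obtain ⟨r, hr⟩ := hdet 0 a b
    have h := hr _ (B i₀).2 _ (B i₁).2
    rw [errorOp_eq 0 (a, b), horth, mul_zero] at h
    simpa using h
  -- Fourier inversion in b isolates a single product of coordinates; choosing the shift a to align
  -- nonzero coordinates of the two orthogonal vectors gives a contradiction.
  have hprod : ∀ a x : ι → F,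
      starRingEnd ℂ ((B i₀ : State ι F) (x + a)) * (B i₁ : State ι F) x = 0 := by
    intro a y
    have h1 : ∑ b : ι → F, traceChar F hω (-(b ⬝ᵥ y)) *
        inner ℂ (B i₀ : State ι F) (weylOp p ω (a, b) (B i₁ : State ι F)) = 0 :=
      Finset.sum_eq_zero fun b _ => by rw [hinner, mul_zero]
    have h2 : ∀ b : ι → F, traceChar F hω (-(b ⬝ᵥ y)) *
        inner ℂ (B i₀ : State ι F) (weylOp p ω (a, b) (B i₁ : State ι F)) =
        ∑ x : ι → F, traceChar F hω ((x - y) ⬝ᵥ b) *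
          (starRingEnd ℂ ((B i₀ : State ι F) (x + a)) * (B i₁ : State ι F) x) := by
      intro b
      rw [PiLp.inner_apply, ← Equiv.sum_comp (Equiv.addRight a), Finset.mul_sum]
      refine Finset.sum_congr rfl fun x _ => ?_
      rw [weylOp_apply hω, Equiv.coe_addRight, add_sub_cancel_right, sub_eq_add_neg x y,
        add_dotProduct, AddChar.map_add_eq_mul, neg_dotProduct, dotProduct_comm y b,
        dotProduct_comm x b, RCLike.inner_apply]
      ring
    simp only [h2] at h1
    rw [Finset.sum_comm, Finset.sum_eq_single y] at h1
    · simpa using h1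
    · intro x _ hx
      rw [← Finset.sum_mul, sum_traceChar_dotProduct hω (sub_ne_zero.2 hx), zero_mul]
    · simp
  obtain ⟨x, hx⟩ := hnz i₁
  obtain ⟨z, hz⟩ := hnz i₀
  have h := hprod (z - x) x
  rw [add_sub_cancel] at h
  rcases mul_eq_zero.1 h with h | h
  · exact hz ((map_eq_zero _).1 h)
  · exact hx h

/-- The minimum distance of a stabilizer code of dimension at least two is bounded from below by
that of the symplectic dual of the stabilizer. -/
theorem exists_hasQuantumDistance [DecidableEq F] (hω : IsPrimitiveRoot ω p)
    {L : AddSubgroup ((ι → F) × (ι → F))} {χ : (ι → F) × (ι → F) → ℂ} {D : ℕ}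
    (hdual : ∀ g : (ι → F) × (ι → F), g ≠ 0 →
      (∀ c ∈ L, traceChar F hω (symplecticForm c g) = 1) → D ≤ quantumWeight g.1 g.2)
    (hQ : 2 ≤ Module.finrank ℂ (jointEigenspace p ω L χ)) :
    ∃ d, HasQuantumDistance p ω (jointEigenspace p ω L χ) d ∧ D ≤ d := by
  classical
  -- The distance is the least weight of an undetected error; such errors exist because the code has
  -- dimension at least two.
  have hex : ∃ d : ℕ, ∃ (c : ZMod p) (a b : ι → F), quantumWeight a b = d ∧
      ¬ Detects (jointEigenspace p ω L χ) (errorOp p ω c a b) := by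
    obtain ⟨c, a, b, h⟩ := exists_not_detects hω hQ
    exact ⟨_, c, a, b, rfl, h⟩
  refine ⟨Nat.find hex, ⟨fun c a b hlt => ?_, Nat.find_spec hex⟩, ?_⟩
  · by_contra h
    exact Nat.find_min hex hlt ⟨c, a, b, rfl, h⟩
  · obtain ⟨c, a, b, hw, hnd⟩ := Nat.find_spec hex
    rw [← hw]
    by_contra hlt
    apply hnd
    by_cases h0 : ((a, b) : (ι → F) × (ι → F)) = 0
    · refine ⟨ω ^ c.val, fun φ _ ψ _ => ?_⟩
      rw [errorOp_eq c (a, b), h0, weylOp_zero hω, LinearMap.smul_apply, Module.End.one_apply,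
        inner_smul_right]
    · have h1 : ∃ s ∈ L, traceChar F hω (symplecticForm s (a, b)) ≠ 1 := by
        by_contra! h
        exact hlt (hdual _ h0 h)
      obtain ⟨s, hs, hs1⟩ := h1
      refine ⟨0, fun φ hφ ψ hψ => ?_⟩
      rw [errorOp_eq c (a, b), LinearMap.smul_apply, inner_smul_right,
        inner_weylOp_eq_zero hω hs hs1 hφ hψ, mul_zero, zero_mul]

end Stabilizer

end QuantumGRL

namespace QuantumGRL

open Matrix

/-! ### From Hermitian self-orthogonal codes to stabilizer codes. -/

section HermitianConstruction

variable {ι F K : Type*} [Field F] [Field K] [Algebra F K]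

/-- The identification `(a, b) ↦ β a + β' b` of labels of errors with vectors over `K`. -/
def labelMap (β β' : K) : (ι → F) × (ι → F) →ₗ[F] (ι → K) where
  toFun c i := β * algebraMap F K (c.1 i) + β' * algebraMap F K (c.2 i)
  map_add' c g := by
    ext i
    simp only [Prod.fst_add, Prod.snd_add, Pi.add_apply, map_add]
    ring
  map_smul' r c := by
    ext i
    simp only [Prod.smul_fst, Prod.smul_snd, Pi.smul_apply, smul_eq_mul, map_mul, RingHom.id_apply,
      Algebra.smul_def r (_ : K)]
    ring

theorem labelMap_apply (β β' : K) (c : (ι → F) × (ι → F)) (i : ι) :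
    labelMap β β' c i = β * algebraMap F K (c.1 i) + β' * algebraMap F K (c.2 i) := rfl

theorem labelMap_apply_eq_zero_iff {β β' : K} (hβ : LinearIndependent F ![β, β'])
    (c : (ι → F) × (ι → F)) (i : ι) : labelMap β β' c i = 0 ↔ (c.1 i, c.2 i) = 0 := by
  rw [labelMap_apply, Prod.mk_eq_zero]
  constructor
  · intro h
    refine LinearIndependent.pair_iff.1 hβ _ _ ?_
    rw [Algebra.smul_def, Algebra.smul_def, ← h]
    ring
  · rintro ⟨h1, h2⟩
    simp [h1, h2]

theorem hammingNorm_labelMap [Fintype ι] [DecidableEq F] [DecidableEq K] {β β' : K}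
    (hβ : LinearIndependent F ![β, β']) (c : (ι → F) × (ι → F)) :
    hammingNorm (labelMap β β' c) = quantumWeight c.1 c.2 := by
  simp only [hammingNorm, quantumWeight, ne_eq, labelMap_apply_eq_zero_iff hβ]

theorem ne_and_sq_sub_sq_ne_zero_of_linearIndependent {β β' : K} (hβ : LinearIndependent F ![β, β']) :
    β' ≠ β ∧ β' ^ 2 - β ^ 2 ≠ 0 := by
  have h := LinearIndependent.pair_iff.1 hβ
  have h1 : β' ≠ β := fun h1 => by simpa using h 1 (-1) (by simp [h1])
  have h2 : β' ≠ -β := fun h2 => by simpa using h 1 1 (by simp [h2])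
  refine ⟨h1, ?_⟩
  rw [sub_ne_zero, Ne, sq_eq_sq_iff_eq_or_eq_neg]
  exact fun h => h.elim h1 h2

variable [Fintype ι] [Fintype F] [Fintype K] {q : ℕ}

/-- For a generator g of Kˣ, a relation g^q = a g with a in F would give g^((q-1)²) = 1, below its
order (q + 1)(q - 1). -/
theorem exists_linearIndependent_frobenius (hF : Fintype.card F = q)
    (hK : Fintype.card K = q ^ 2) : ∃ β : K, LinearIndependent F ![β, β ^ q] := by
  have hq : 1 < q := hF ▸ Fintype.one_lt_card
  obtain ⟨g, hg⟩ := IsCyclic.exists_ofOrder_eq_natCard (α := Kˣ)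
  rw [Nat.card_units, Nat.card_eq_fintype_card, hK] at hg
  refine ⟨g, (LinearIndependent.pair_iff' g.ne_zero).2 fun a ha => ?_⟩
  have h1 : algebraMap F K a = (g : K) ^ (q - 1) := by
    apply mul_right_cancel₀ g.ne_zero
    rw [← Algebra.smul_def, ha, ← pow_succ, Nat.sub_add_cancel hq.le]
  have ha0 : a ≠ 0 := by
    rintro rfl
    rw [map_zero] at h1
    exact pow_ne_zero _ g.ne_zero h1.symm
  have h2 : g ^ ((q - 1) * (q - 1)) = 1 := by
    ext
    rw [Units.val_pow_eq_pow_val, pow_mul, ← h1, ← map_pow, ← hF,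
      FiniteField.pow_card_sub_one_eq_one a ha0, map_one, Units.val_one]
  have h3 := orderOf_le_of_pow_eq_one (Nat.mul_pos (by omega) (by omega)) h2
  rw [hg, show q ^ 2 - 1 = (q + 1) * (q - 1) by simpa using Nat.sq_sub_sq q 1] at h3
  have := Nat.le_of_mul_le_mul_right h3 (by omega)
  omega

theorem labelMap_bijective (hF : Fintype.card F = q) (hK : Fintype.card K = q ^ 2) {β β' : K}
    (hβ : LinearIndependent F ![β, β']) :
    Function.Bijective (labelMap β β' : (ι → F) × (ι → F) →ₗ[F] (ι → K)) := by
  classical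
  rw [Fintype.bijective_iff_injective_and_card]
  constructor
  · rw [← LinearMap.ker_eq_bot, LinearMap.ker_eq_bot']
    intro c hc
    have h := fun i => (labelMap_apply_eq_zero_iff hβ c i).1 (congrFun hc i)
    exact Prod.ext (funext fun i => (Prod.mk_eq_zero.1 (h i)).1)
      (funext fun i => (Prod.mk_eq_zero.1 (h i)).2)
  · rw [Fintype.card_prod, Fintype.card_fun, Fintype.card_fun, hF, hK, ← sq, ← pow_mul, ← pow_mul,
      mul_comm]

/-- Conjugation x ↦ x^q exchanges β and β^q, because β^(q²) = β; expanding, the symmetric terms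
cancel. -/
theorem hermitianForm_sub_swap (hF : Fintype.card F = q) (hK : Fintype.card K = q ^ 2) (β : K)
    (c g : (ι → F) × (ι → F)) :
    ∑ i, labelMap β (β ^ q) c i * labelMap β (β ^ q) g i ^ q -
      ∑ i, labelMap β (β ^ q) g i * labelMap β (β ^ q) c i ^ q =
      ((β ^ q) ^ 2 - β ^ 2) * algebraMap F K (symplecticForm c g) := by
  have hconj : ∀ (c : (ι → F) × (ι → F)) (i : ι), labelMap β (β ^ q) c i ^ q =
      β ^ q * algebraMap F K (c.1 i) + β * algebraMap F K (c.2 i) := by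
    intro c i
    have h : ∀ x : K, FiniteField.frobeniusAlgHom F K x = x ^ q := fun x => by
      rw [FiniteField.coe_frobeniusAlgHom, hF]
    rw [← h, labelMap_apply, map_add, map_mul, map_mul, AlgHom.commutes, AlgHom.commutes, h, h,
      ← pow_mul, ← sq, ← hK, FiniteField.pow_card]
  simp only [hconj]
  rw [← Finset.sum_sub_distrib, symplecticForm, dotProduct, dotProduct, ← Finset.sum_sub_distrib,
    map_sum, Finset.mul_sum]
  refine Finset.sum_congr rfl fun i _ => ?_
  simp only [labelMap_apply, map_sub, map_mul]
  ring

/-- The Hermitian construction of stabilizer codes. -/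
theorem exists_hermitianStabilizerCode [DecidableEq ι] [DecidableEq F] [DecidableEq K]
    {p : ℕ} [Fact p.Prime] [Algebra (ZMod p) F] {ω : ℂ} (hω : IsPrimitiveRoot ω p)
    (hF : Fintype.card F = q) (hK : Fintype.card K = q ^ 2) {C : Submodule K (ι → K)} {k D : ℕ}
    (hC : IsHermitianSelfOrthogonal q C) (hD : MinDistanceGE (hermitianDual q C) D)
    (hk : Module.finrank K C = k) (hkι : 2 * k < Fintype.card ι) :
    ∃ (Q : Submodule ℂ (State ι F)) (d : ℕ), IsHermitianStabilizerCode p ω C Q ∧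
      IsQuantumCode p ω (Fintype.card ι) (Fintype.card ι - 2 * k) d Q ∧ D ≤ d := by
  have hq : 1 < q := hF ▸ Fintype.one_lt_card
  obtain ⟨β, hβ⟩ := exists_linearIndependent_frobenius hF hK
  obtain ⟨hβ1, hβ2⟩ := ne_and_sq_sub_sq_ne_zero_of_linearIndependent hβ
  have hbij := labelMap_bijective (ι := ι) hF hK hβ
  have hform := hermitianForm_sub_swap (ι := ι) hF hK β
  set ℓ : (ι → F) × (ι → F) →ₗ[F] (ι → K) := labelMap β (β ^ q) with hℓ
  let L : AddSubgroup ((ι → F) × (ι → F)) := C.toAddSubgroup.comap ℓ.toAddMonoidHom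
  have hL : ∀ c, c ∈ L ↔ ℓ c ∈ C := fun c => Iff.rfl
  have hiso : ∀ c ∈ L, ∀ g ∈ L, symplecticForm c g = 0 := by
    intro c hc g hg
    have h := hform c g
    rw [hC ((hL c).1 hc) _ ((hL g).1 hg), hC ((hL g).1 hg) _ ((hL c).1 hc), sub_zero, eq_comm, mul_eq_zero] at h
    exact (map_eq_zero _).1 (h.resolve_left hβ2)
  obtain ⟨χ, ψ, hψ0, hψ⟩ := exists_joint_eigenvector hω L hiso
  have hcardL : Nat.card L = q ^ (2 * k) := by
    have h1 : Nat.card L = Nat.card C :=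
      Nat.card_congr ((Equiv.ofBijective ℓ hbij).subtypeEquiv hL)
    rw [h1, Module.natCard_eq_pow_finrank (K := K), Nat.card_eq_fintype_card, hK, hk, pow_mul]
  have hdim : Module.finrank ℂ (jointEigenspace p ω L χ) = q ^ (Fintype.card ι - 2 * k) := by
    have h := finrank_jointEigenspace_mul_card hω hψ0 (mem_jointEigenspace.2 hψ)
    rw [hcardL, hF] at h
    refine Nat.eq_of_mul_eq_mul_right (pow_pos (by omega : 0 < q) (2 * k)) ?_
    rw [h, ← pow_add, Nat.sub_add_cancel hkι.le]
  have hdual : ∀ g : (ι → F) × (ι → F), g ≠ 0 →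
      (∀ c ∈ L, traceChar F hω (symplecticForm c g) = 1) → D ≤ quantumWeight g.1 g.2 := by
    intro g hg0 hg
    rw [← hammingNorm_labelMap hβ g, ← hℓ]
    refine hD _ ?_ fun h => hg0 (hbij.1 (h.trans (map_zero ℓ).symm))
    -- L is stable under F, so a nonzero value could be scaled to one where the trace character is
    -- nontrivial.
    have hsymp : ∀ c ∈ L, symplecticForm c g = 0 := by
      intro c hc
      by_contra hne
      obtain ⟨y, hy⟩ := exists_traceChar_mul_ne_one hω hne
      apply hy
      have hyc : y • c ∈ L := by
        rw [hL, map_smul, ← algebraMap_smul K y]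
        exact C.smul_mem _ hc
      have h := hg _ hyc
      have h1 : symplecticForm (y • c) g = symplecticForm c g * y := by
        simp only [symplecticForm, Prod.smul_fst, Prod.smul_snd, smul_dotProduct, dotProduct_smul,
          smul_eq_mul]
        ring
      rwa [h1] at h
    have hswap : ∀ u ∈ C, ∑ i, u i * ℓ g i ^ q = ∑ i, ℓ g i * u i ^ q := by
      intro u hu
      obtain ⟨c, rfl⟩ := hbij.2 u
      have h := hform c g
      rw [hsymp c hu, map_zero, mul_zero, sub_eq_zero] at h
      exact h
    intro u hu
    -- C is K-linear, so the symmetry also holds for β u. It scales the two sides by β and β^q,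
    -- which differ, so both vanish.
    have h := hswap (β • u) (C.smul_mem β hu)
    simp only [Pi.smul_apply, smul_eq_mul, mul_pow, mul_assoc, mul_left_comm _ (β ^ q),
      ← Finset.mul_sum] at h
    rw [hswap u hu, ← sub_eq_zero, ← sub_mul, mul_eq_zero, sub_eq_zero] at h
    exact h.resolve_left hβ1.symm
  obtain ⟨d, hd, hDd⟩ := exists_hasQuantumDistance hω hdual (by
    rw [hdim]
    calc 2 ≤ q ^ 1 := by rwa [pow_one]
      _ ≤ q ^ (Fintype.card ι - 2 * k) := Nat.pow_le_pow_right (by omega) (by omega))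
  refine ⟨jointEigenspace p ω L χ, d, ⟨β, by rwa [hF], fun a b => χ (a, b), fun φ => ?_⟩,
    ⟨rfl, by rw [hdim, hF], hd⟩, hDd⟩
  rw [mem_jointEigenspace, hF]
  exact ⟨fun h a b => h (a, b), fun h c => h c.1 c.2⟩

end HermitianConstruction

end QuantumGRL

/-! ### Assembly of the theorem. -/

theorem mainTheorem10
    (p q m k : ℕ) [Fact p.Prime]
    (F K : Type*) [Field F] [Field K] [Fintype F] [Fintype K] [DecidableEq F] [DecidableEq K]
    [Algebra (ZMod p) F] [Algebra F K]
    (hF : Fintype.card F = q) (hK : Fintype.card K = q ^ 2)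
    (ω : ℂ) (hω : IsPrimitiveRoot ω p)
    (hq : 5 ≤ q) (hm₂ : 2 ≤ m) (hm : m ≤ q - 3) (hk₄ : 4 ≤ k) (hk : k ≤ m + 2) :
    ∃ (C : Submodule K (Fin (m * (q + 1) + 3) → K))
      (Q : Submodule ℂ (QuantumGRL.State (Fin (m * (q + 1) + 3)) F)) (d : ℕ),
      QuantumGRL.IsQuantumGRLCode (n := m * (q + 1)) (s := 3) p ω k C Q ∧
      Module.finrank K C = k ∧
      QuantumGRL.MinDistanceGE C (m * (q + 1) - k + 2) ∧
      QuantumGRL.MinDistanceGE (QuantumGRL.hermitianDual q C) (k - 1) ∧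
      QuantumGRL.IsQuantumCode p ω (m * (q + 1) + 3) (m * (q + 1) + 3 - 2 * k) d Q ∧
      k - 1 ≤ d := by
  obtain ⟨r, rfl⟩ : ∃ r, k = r + 3 := ⟨k - 3, by omega⟩
  -- As k ≤ m + 2, this yields both k ≤ n and 2k < n + 3; the latter makes the dimension of Q at
  -- least q.
  have hn : 2 * (m + 2) ≤ m * (q + 1) := by
    calc 2 * (m + 2) ≤ m * 6 := by omega
      _ ≤ m * (q + 1) := Nat.mul_le_mul_left _ (by omega)
  obtain ⟨α, v, d, hα, hv, hd, hsum⟩ :=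
    QuantumGRL.exists_grl_parameters hF hK hm₂ (by omega) (by omega : r + 1 ≤ m)
  have hself := QuantumGRL.hermitianSelfOrthogonal_grlCode
    (FiniteField.frobeniusAlgHom F K).toRingHom
    (fun x => by simp [hF]) (by omega) hsum
  have hdual := QuantumGRL.minDistanceGE_hermitianDual_grlCode (r := r) (q := q) (by omega) hα hv hd
  have hdim := QuantumGRL.finrank_grlCode (r := r) (d := d) hα hv (by omega)
  obtain ⟨Q, δ, hQ, hQcode, hδ⟩ := QuantumGRL.exists_hermitianStabilizerCode hω hF hK hself hdual
    hdim (by rw [Fintype.card_fin]; omega)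
  rw [Fintype.card_fin] at hQcode
  exact ⟨_, Q, δ, ⟨QuantumGRL.isGRLCode_diagonal (by omega) hα hv hd, by rwa [hF], hQ⟩, hdim,
    QuantumGRL.minDistanceGE_grlCode hα hv hd (by omega), hdual, hQcode, hδ⟩
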